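/- Let $M$ be a monoid and let $\tau$ be any topology on its underlying set (no compatibility between $\tau$ and the multiplication is assumed). Let $\mathrm{PSh}(M)$ be the category of right $M$-sets (presheaves of sets on the one-object category $M$), and let $\mathrm{Cont}(M,\tau)$ be its full subcategory on the $(M,\tau)$-sets, i.e. those $X$ whose action $X\times M\to X$ is continuous when $X$ is discrete, $M$ carries $\tau$, and $X\times M$ carries the product topology. Let $V:\mathrm{Cont}(M,\tau)\to\mathrm{PSh}(M)$ be the forgetful functor. For an $M$-set $X$, $x\in X$ and $p\in M$ put $\mathcal I_x^p=\{m\in M\mid xm=xp\}$ and $\mathfrak r_x=\{(p,q)\in M\times M\mid xp=xq\}$. Then: 1. $V$ is left exact and comonadic. Its right adjoint $R$ sends an $M$-set $X$ to its sub-$M$-set of continuous elements $$R(X)=\{x\in X\mid \forall p,q\in M,\ \mathcal I_{xq}^p\in\tau\}=\{x\in X\mid\forall q\in M,\ \mathfrak r_{xq}\text{ is open in }M\times M\},$$ with counit the inclusion $R(X)\hookrightarrow X$. If moreover for every $q\in M$ the left multiplication $m\mapsto qm$ is continuous for $\tau$, then $$R(X)=\{x\in X\mid\forall p\in M,\ \mathcal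 I_x^p\in\tau\}=\{x\in X\mid\mathfrak r_x\text{ is open in }M\times M\}.$$ 2. $\mathrm{Cont}(M,\tau)$ is an elementary topos, and the geometric morphism $\mathrm{PSh}(M)\to\mathrm{Cont}(M,\tau)$ with inverse image $V$ and direct image $R$ is hyperconnected: $V$ is full and faithful, and its image is closed under subobjects and quotients in $\mathrm{PSh}(M)$. 3. $\mathrm{Cont}(M,\tau)$ is a Grothendieck topos (equivalent to the category of sheaves of sets on a small site). It is supercompactly generated: its supercompact objects, i.e. those $C$ such that every jointly epic family $\{A_i\to C\mid i\in I\}$ contains an epimorphism, form up to isomorphism a set, and this set is separating. It is two-valued: it has exactly two subterminal objects up to isomorphism. It has enough points: there is a set of geometric morphisms $\mathbf{Set}\to\mathrm{Cont}(M,\tau)$ whose inverse image functors are jointly conservative. -/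

import Mathlib

open CategoryTheory CategoryTheory.Limits Opposite

universe u v w u₁ v₁ u₂ v₂

/-! ### Topos-theoretic notions -/

/-- An elementary topos: finite limits, cartesian closed, with a subobject classifier. -/
structure IsElementaryTopos (E : Type w) [Category.{v} E] : Prop where
  hasFiniteLimits : HasFiniteLimits E
  cartesianClosed : ∃ _ : CartesianMonoidalCategory E, Nonempty (MonoidalClosed E)
  hasSubobjectClassifier : HasSubobjectClassifier E

/-- A Grothendieck topos: a category equivalent to the category of sheaves of sets on a
small site. -/
def IsGrothendieckTopos (E : Type w) [Category.{v} E] : Prop :=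
  ∃ (C : Type v) (_ : SmallCategory C) (J : GrothendieckTopology C),
    Nonempty (E ≌ Sheaf J (Type v))

/-- A topos is two-valued if it has exactly two subterminal objects (up to isomorphism). -/
def IsTwoValued (E : Type w) [Category.{v} E] : Prop :=
  ∃ T : E, Nonempty (IsTerminal T) ∧ Nat.card (Subobject T) = 2

/-- A family of morphisms with common codomain is jointly epic. -/
def JointlyEpic {E : Type w} [Category.{v} E] {I : Type u} {A : I → E} {C : E}
    (f : ∀ i, A i ⟶ C) : Prop :=
  ∀ ⦃Z : E⦄ (g h : C ⟶ Z), (∀ i, f i ≫ g = f i ≫ h) → g = h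

/-- An object is supercompact if every (small) jointly epic family of morphisms into it
contains an epimorphism. -/
def supercompact (E : Type w) [Category.{v} E] : ObjectProperty E := fun C =>
  ∀ (I : Type v) (A : I → E) (f : ∀ i, A i ⟶ C), JointlyEpic f → ∃ i, Epi (f i)

/-- A topos is supercompactly generated if its supercompact objects form, up to isomorphism,
a set, and this set is separating. -/
structure IsSupercompactlyGenerated (E : Type w) [Category.{v} E] : Prop where
  essentiallySmall : ObjectProperty.EssentiallySmall.{v} (supercompact E)
  isSeparating : (supercompact E).IsSeparating

/-- A geometric morphism `F ⟶ E`: a direct image functor `F ⥤ E` with a left exact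
left adjoint, the inverse image functor. -/
structure GeometricMorphism (F : Type u₁) [Category.{v₁} F] (E : Type u₂) [Category.{v₂} E] where
  direct : F ⥤ E
  inverse : E ⥤ F
  adj : inverse ⊣ direct
  leftExact : PreservesFiniteLimits inverse

/-- A geometric morphism is hyperconnected if its inverse image functor is full and faithful,
with image closed under subobjects and quotients. -/
structure GeometricMorphism.IsHyperconnected {F : Type u₁} [Category.{v₁} F]
    {E : Type u₂} [Category.{v₂} E] (f : GeometricMorphism F E) : Prop where
  full : f.inverse.Full
  faithful : f.inverse.Faithful
  subobjects : ∀ (X : E) (A : F) (i : A ⟶ f.inverse.obj X), Mono i → f.inverse.essImage A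
  quotients : ∀ (X : E) (A : F) (p : f.inverse.obj X ⟶ A), Epi p → f.inverse.essImage A

/-- A topos has enough points if there is a set of points, that is, of geometric morphisms
from the topos of sets, whose inverse image functors are jointly conservative. -/
def HasEnoughPoints (E : Type w) [Category.{v} E] : Prop :=
  ∃ (I : Type v) (p : I → GeometricMorphism (Type v) E),
    JointlyReflectIsomorphisms (fun i => (p i).inverse)

/-! ### Continuous actions of a monoid equipped with a topology -/

/-- The category of right `M`-sets, as presheaves on the one-object category `M`. -/
abbrev PSh (M : Type u) [Monoid M] : Type (u + 1) := (SingleObj M)ᵒᵖ ⥤ Type u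

namespace PSh

variable {M : Type u} [Monoid M]

/-- The underlying set of a right `M`-set. -/
abbrev carrier (X : PSh M) : Type u := X.obj (op (SingleObj.star M))

/-- The right action `(x, m) ↦ xm`. -/
def act (X : PSh M) (x : X.carrier) (m : M) : X.carrier :=
  X.map (Quiver.Hom.op (SingleObj.toEnd M m)) x

theorem act_one (X : PSh M) (x : X.carrier) : X.act x 1 = x :=
  Functor.map_id_apply X _ x

theorem act_mul (X : PSh M) (x : X.carrier) (m n : M) :
    X.act x (m * n) = X.act (X.act x m) n :=
  Functor.map_comp_apply X (Quiver.Hom.op (SingleObj.toEnd M m))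
    (Quiver.Hom.op (SingleObj.toEnd M n)) x

theorem map_act {X Y : PSh M} (f : X ⟶ Y) (x : X.carrier) (m : M) :
    f.app (op (SingleObj.star M)) (X.act x m) = Y.act (f.app (op (SingleObj.star M)) x) m :=
  NatTrans.naturality_apply f (Quiver.Hom.op (SingleObj.toEnd M m)) x

/-- The necessary clopen `I_x^p = {m | xm = xp}`. -/
def necessaryClopen (X : PSh M) (x : X.carrier) (p : M) : Set M :=
  {m | X.act x m = X.act x p}

/-- The equivalence relation `r_x = {(p, q) | xp = xq}` on `M`. -/
def rel (X : PSh M) (x : X.carrier) : Set (M × M) :=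
  {pq | X.act x pq.1 = X.act x pq.2}

/-- A right `M`-set is continuous if its action map `X × M → X` is continuous, where `X` has
the discrete topology and `X × M` the product topology. -/
def isContinuous (M : Type u) [Monoid M] [TopologicalSpace M] : ObjectProperty (PSh M) :=
  fun X =>
    letI : TopologicalSpace X.carrier := ⊥
    Continuous (fun p : X.carrier × M => X.act p.1 p.2)

variable [TopologicalSpace M]

/-- The `M`-subset of continuous elements of `X`: those `x` such that `I_{xq}^p` is open for
all `p` and `q`. -/
def contElements (X : PSh M) : Subfunctor X where
  obj _ := {x : X.carrier | ∀ p q : M, IsOpen (X.necessaryClopen (X.act x q) p)}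
  map {U V} i := by
    intro x hx p q
    have h := hx p (i.unop * q)
    rw [act_mul] at h
    exact h

theorem isContinuous_contElements (X : PSh M) :
    isContinuous M X.contElements.toFunctor := by
  let Y : PSh M := X.contElements.toFunctor
  let _ : TopologicalSpace Y.carrier := ⊥
  have : DiscreteTopology Y.carrier := ⟨rfl⟩
  refine continuous_prod_of_discrete_left.mpr fun y => ?_
  refine continuous_discrete_rng.mpr fun z => isOpen_iff_forall_mem_open.mpr fun m hm => ?_
  refine ⟨X.necessaryClopen (X.act y.1 1) m, fun n hn => ?_, y.2 m 1, rfl⟩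
  have hn' : X.act (X.act y.1 1) n = X.act (X.act y.1 1) m := hn
  rw [act_one] at hn'
  exact Subtype.ext (hn'.trans (congrArg Subtype.val hm))

theorem map_mem_contElements {X Y : PSh M} (f : X ⟶ Y) (x : X.carrier)
    (hx : x ∈ X.contElements.obj (op (SingleObj.star M))) :
    f.app (op (SingleObj.star M)) x ∈ Y.contElements.obj (op (SingleObj.star M)) := by
  intro p q
  refine isOpen_iff_forall_mem_open.mpr fun m hm => ?_
  refine ⟨X.necessaryClopen (X.act x q) m, fun n hn => ?_, hx m q, rfl⟩
  have hn' : X.act (X.act x q) n = X.act (X.act x q) m := hn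
  have h := congrArg (f.app (op (SingleObj.star M))) hn'
  rw [map_act, map_act, map_act, map_act] at h
  exact h.trans hm

end PSh

/-- The category of continuous right `M`-sets, a full subcategory of `PSh M`. -/
abbrev ContSets (M : Type u) [Monoid M] [TopologicalSpace M] : Type (u + 1) :=
  (PSh.isContinuous M).FullSubcategory

namespace ContSets

variable (M : Type u) [Monoid M] [TopologicalSpace M]

/-- The forgetful functor from continuous `M`-sets to `M`-sets. -/
abbrev V : ContSets M ⥤ PSh M := (PSh.isContinuous M).ι

/-- The functor sending an `M`-set to its continuous elements, and restricting morphisms. -/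
def R : PSh M ⥤ ContSets M where
  obj X := ⟨X.contElements.toFunctor, X.isContinuous_contElements⟩
  map {X Y} f := ObjectProperty.homMk
    { app := fun U => ↾fun x => ⟨f.app U x.1, PSh.map_mem_contElements f x.1 x.2⟩
      naturality := fun U V i => by
        refine ConcreteCategory.hom_ext _ _ fun x => Subtype.ext ?_
        exact NatTrans.naturality_apply f i (Subtype.val x) }

end ContSets

/-!
The underlying set functor `Cont(M, τ) ⥤ Set` is conservative, preserves finite limits and has a
right adjoint. It is therefore a point which alone detects isomorphisms, and it turns epimorphisms
into surjections and subterminal objects into subsets of a point.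

Every element of a continuous `M`-set `X` lies in a cyclic subobject `M / r`, and these cyclic
`M`-sets form, up to isomorphism, a set. This identifies the supercompact objects. It also makes the
cyclic `M`-sets dense, so that `X ↦ Hom(-, X)` embeds `Cont(M, τ)` reflectively into presheaves on
them. By conservativity, the reflection inverts exactly the morphisms of presheaves that become
bijective on stalks at the point above; for the topology of jointly surjective families, these are
also the morphisms inverted by sheafification. Hence `Cont(M, τ)` is the topos of sheaves on the
cyclic continuous `M`-sets.
-/

/-! ### Categories with a conservative functor to sets -/

theorem IsGrothendieckTopos.isElementaryTopos {E : Type w} [Category.{v} E]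
    (h : IsGrothendieckTopos E) : IsElementaryTopos E := by
  obtain ⟨C, _, J, ⟨e⟩⟩ := h
  have : HasFiniteLimits E := ⟨fun _ _ _ =>
    Adjunction.hasLimitsOfShape_of_equivalence e.functor⟩
  let _ : CartesianMonoidalCategory E := .ofHasFiniteProducts
  have closed : MonoidalClosed (Sheaf J (Type v)) := inferInstance
  exact ⟨inferInstance, ⟨inferInstance, ⟨@cartesianClosedOfEquiv _ _ _ _ _ _ e.symm closed⟩⟩,
    ⟨⟨(HasSubobjectClassifier.exists_classifier (C := Sheaf J (Type v))).some.ofEquivalence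
      e.symm⟩⟩⟩

section ConservativeFiber

variable {E : Type w} [Category.{v} E]

theorem HasEnoughPoints.of_adjunction {F : E ⥤ Type v} {G : Type v ⥤ E} (adj : F ⊣ G)
    [PreservesFiniteLimits F] [F.ReflectsIsomorphisms] : HasEnoughPoints E :=
  ⟨PUnit, fun _ => ⟨G, F, adj, inferInstance⟩,
    ⟨fun f h => (isIso_iff_of_reflects_iso f F).1 (h ⟨⟩)⟩⟩

section Initial

variable (F : E ⥤ Type v₁) [HasInitial E] [PreservesColimit (Functor.empty.{0} E) F]

theorem isEmpty_obj_initial : IsEmpty (F.obj (⊥_ E)) :=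
  (Types.initial_iff_empty _).1 ⟨initialIsInitial.isInitialObj F _⟩

theorem nonempty_isInitial_iff_isEmpty_obj [F.ReflectsIsomorphisms] {X : E} :
    Nonempty (IsInitial X) ↔ IsEmpty (F.obj X) := by
  have := reflectsColimit_of_reflectsIsomorphisms (Functor.empty.{0} E) F
  exact (IsInitial.isInitialIffObj F X).nonempty_congr.trans (Types.initial_iff_empty _)

theorem hasStrictInitialObjects_of_reflectsIsomorphisms [F.ReflectsIsomorphisms] :
    HasStrictInitialObjects E where
  out f hI := by
    have := (nonempty_isInitial_iff_isEmpty_obj F).1 ⟨hI⟩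
    refine (isIso_iff_of_reflects_iso f F).1 ((isIso_iff_bijective _).2 ?_)
    have := Function.isEmpty (F.map f)
    exact ⟨Function.injective_of_subsingleton _, isEmptyElim⟩

theorem IsTwoValued.of_reflectsIsomorphisms [HasTerminal E]
    [PreservesLimit (Functor.empty.{0} E) F] [F.PreservesMonomorphisms] [F.ReflectsIsomorphisms] :
    IsTwoValued E := by
  have := hasStrictInitialObjects_of_reflectsIsomorphisms F
  let uniqueTerminal : Unique (F.obj (⊤_ E)) :=
    ((terminalIsTerminal.isTerminalObj F _).uniqueUpToIso Types.isTerminalPUnit).toEquiv.unique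
  refine ⟨⊤_ E, ⟨terminalIsTerminal⟩, Nat.card_eq_two_iff.2 ⟨⊥, ⊤, fun h => ?_, ?_⟩⟩
  · have : IsIso (initial.to (⊤_ E)) := by
      rwa [Subobject.isIso_iff_mk_eq_top, ← Subobject.bot_eq_initial_to]
    exact (isEmpty_obj_initial F).elim (F.map (inv (initial.to (⊤_ E))) default)
  · refine Set.eq_univ_of_forall fun S => S.ind _ fun A i _ => ?_
    rcases isEmpty_or_nonempty (F.obj A) with hA | ⟨⟨a⟩⟩
    · obtain ⟨hA⟩ := (nonempty_isInitial_iff_isEmpty_obj F).2 hA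
      exact Or.inl (Subobject.mk_eq_mk_of_comm _ _ (hA.uniqueUpToIso initialIsInitial)
        (hA.hom_ext _ _))
    · refine Or.inr ((Subobject.isIso_iff_mk_eq_top i).1 ?_)
      refine (isIso_iff_of_reflects_iso i F).1 ((isIso_iff_bijective _).2 ?_)
      exact ⟨(mono_iff_injective _).1 inferInstance, fun _ => ⟨a, Subsingleton.elim _ _⟩⟩

end Initial

theorem jointlyEpic_iff_jointly_surjective (F : E ⥤ Type v₁) [F.IsLeftAdjoint] [F.Faithful]
    {I : Type u} {A : I → E} {C : E} {f : ∀ i, A i ⟶ C} :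
    JointlyEpic f ↔ ∀ c : F.obj C, ∃ i a, F.map (f i) a = c := by
  refine ⟨fun hf c => ?_, fun hf Z g h w => F.map_injective (ConcreteCategory.hom_ext _ _ ?_)⟩
  · -- The characteristic functions of `F.obj C` and of the union of the images agree on the images.
    let χ : F.obj C ⟶ ULift.{v₁} Prop := ↾fun _ => ⟨True⟩
    let χ' : F.obj C ⟶ ULift.{v₁} Prop := ↾fun c => ⟨∃ i a, F.map (f i) a = c⟩
    have hχ : χ = χ' := by
      refine ((Adjunction.ofIsLeftAdjoint F).homEquiv _ _).injective (hf _ _ fun i => ?_)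
      rw [← Adjunction.homEquiv_naturality_left, ← Adjunction.homEquiv_naturality_left]
      congr 1
      ext a
      exact ⟨fun _ => ⟨i, a, rfl⟩, fun _ => trivial⟩
    exact of_eq_true (congrArg ULift.down (ConcreteCategory.congr_hom hχ c)).symm
  · intro c
    obtain ⟨i, a, rfl⟩ := hf c
    rw [← F.map_comp_apply, ← F.map_comp_apply, w]

end ConservativeFiber

/-! ### Sheaves on a small generating subcategory -/

theorem nonempty_isColimit_of_exists_span {J : Type u} [Category.{v} J] {K : J ⥤ Type w}
    (c : Cocone K) (exists_preimage : ∀ x : c.pt, ∃ j y, c.ι.app j y = x)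
    (exists_span : ∀ (a b : J) (x : K.obj a) (y : K.obj b), c.ι.app a x = c.ι.app b y →
      ∃ (d : J) (l : d ⟶ a) (r : d ⟶ b) (z : K.obj d), K.map l z = x ∧ K.map r z = y) :
    Nonempty (IsColimit c) := by
  refine (Types.isColimit_iff_coconeTypesIsColimit _).2 ⟨fun s t hst => ?_,
    (Functor.CoconeTypes.descColimitType_surjective_iff _).2 exists_preimage⟩
  obtain ⟨a, x, rfl⟩ := Functor.ιColimitType_jointly_surjective _ s
  obtain ⟨b, y, rfl⟩ := Functor.ιColimitType_jointly_surjective _ t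
  obtain ⟨d, l, r, z, rfl, rfl⟩ := exists_span a b x y hst
  rw [K.ιColimitType_map, K.ιColimitType_map]

/-- The elements of the sets `F X` all come, along morphisms of `E`, from the objects in the image
of `ι`. For `F` conservative, this says that these objects generate `E`. -/
def CoversFibers {C : Type u} [Category.{u₁} C] {E : Type w} [Category.{v} E] (ι : C ⥤ E)
    (F : E ⥤ Type v₁) : Prop :=
  ∀ (X : E) (x : F.obj X), ∃ (c : C) (f : ι.obj c ⟶ X) (y : F.obj (ι.obj c)), F.map f y = x

namespace CoversFibers

variable {C : Type u} [Category.{u₁} C] {E : Type w} [Category.{v} E] {ι : C ⥤ E}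
  {F : E ⥤ Type v₁}

theorem isCofiltered_elements [ι.Full] [ι.Faithful] [HasFiniteLimits E] [PreservesFiniteLimits F]
    (h : CoversFibers ι F) : IsCofiltered (ι ⋙ F).Elements := by
  have : IsCofiltered F.Elements := F.isCofiltered_elements
  have : (Functor.Elements.precomp ι F).Full := ⟨fun {x _} f =>
    ⟨⟨ι.preimage f.1, (congrArg (F.map · x.2) (ι.map_preimage f.1)).trans f.2⟩,
      Subtype.ext (ι.map_preimage f.1)⟩⟩
  have : (Functor.Elements.precomp ι F).Faithful :=
    ⟨fun hfg => Subtype.ext (ι.map_injective (congrArg Subtype.val hfg))⟩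
  refine IsCofiltered.of_exists_of_isCofiltered_of_fullyFaithful (Functor.Elements.precomp ι F) ?_
  rintro ⟨X, x⟩
  obtain ⟨c, f, y, hy⟩ := h X x
  exact ⟨⟨c, y⟩, ⟨⟨f, hy⟩⟩⟩

theorem isDense [ι.Full] [HasPullbacks E] [PreservesLimitsOfShape WalkingCospan F]
    [F.ReflectsIsomorphisms] [∀ X, HasColimitsOfShape (CostructuredArrow ι X) E]
    [∀ X, PreservesColimitsOfShape (CostructuredArrow ι X) F]
    (h : CoversFibers ι F) : ι.IsDense where
  isDenseAt X := by
    let canonical := (Functor.LeftExtension.mk (𝟭 E) ι.rightUnitor.inv).coconeAt X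
    have map_canonical (a : CostructuredArrow ι X) : F.map (canonical.ι.app a) = F.map a.hom :=
      congrArg F.map (Category.id_comp _)
    -- As `F` is conservative, it suffices that the canonical cocone is a colimit in sets.
    have := reflectsColimit_of_reflectsIsomorphisms (CostructuredArrow.proj ι X ⋙ ι) F
    refine ⟨isColimitOfReflects F (nonempty_isColimit_of_exists_span _ (fun x => ?_) ?_).some⟩
    · obtain ⟨c, f, y, rfl⟩ := h X x
      exact ⟨.mk f, y, ConcreteCategory.congr_hom (map_canonical (.mk f)) y⟩
    · intro a b x y hxy
      replace hxy : F.map a.hom x = F.map b.hom y := by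
        rw [← map_canonical, ← map_canonical]
        exact hxy
      obtain ⟨p, rfl, rfl⟩ := Types.exists_of_isPullback
        ((IsPullback.of_hasPullback a.hom b.hom).map F) x y hxy
      obtain ⟨c, f, z, rfl⟩ := h _ p
      obtain ⟨l, hl⟩ := ι.map_surjective (f ≫ pullback.fst a.hom b.hom)
      obtain ⟨r, hr⟩ := ι.map_surjective (f ≫ pullback.snd a.hom b.hom)
      refine ⟨.mk (f ≫ pullback.fst a.hom b.hom ≫ a.hom), CostructuredArrow.homMk l ?_,
        CostructuredArrow.homMk r ?_, z, ?_, ?_⟩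
      · simp [hl]
      · simp [hr, pullback.condition]
      · exact (congrArg (F.map · z) hl).trans (F.map_comp_apply f _ z)
      · exact (congrArg (F.map · z) hr).trans (F.map_comp_apply f _ z)

end CoversFibers

section FiberTopology

variable {C : Type u} [Category.{v} C] (F : C ⥤ Type w) [IsCofiltered F.Elements]

/-- The Grothendieck topology whose covering sieves are those that `F` sends to jointly surjective
families. Covering sieves are stable under pullback because `F` is flat, that is, because its
category of elements is cofiltered. -/
def fiberTopology : GrothendieckTopology C where
  sieves X := {S | ∀ x : F.obj X, ∃ (Y : C) (f : Y ⟶ X) (_ : S f) (y : F.obj Y), F.map f y = x}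
  top_mem' X x := ⟨X, 𝟙 X, trivial, x, F.map_id_apply X x⟩
  pullback_stable' X Y S g hS y := by
    obtain ⟨Z, f, hf, z, hz⟩ := hS (F.map g y)
    let e : F.elementsMk Y y ⟶ F.elementsMk X (F.map g y) := ⟨g, rfl⟩
    let e' : F.elementsMk Z z ⟶ F.elementsMk X (F.map g y) := ⟨f, hz⟩
    obtain ⟨W, p, q, h⟩ := IsCofiltered.cospan e e'
    have comm : p.1 ≫ g = q.1 ≫ f := congrArg Subtype.val h
    refine ⟨W.1, p.1, ?_, W.2, p.2⟩
    rw [Sieve.pullback_apply, comm]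
    exact S.downward_closed hf q.1
  transitive' X S hS R hR x := by
    obtain ⟨Y, f, hf, y, rfl⟩ := hS x
    obtain ⟨Z, g, hg, z, rfl⟩ := hR hf y
    exact ⟨Z, g ≫ f, hg, z, F.map_comp_apply g f z⟩

/-- The tautological point of `fiberTopology F`, with fiber functor `F`. -/
def fiberPoint [EssentiallySmall.{w} C] : (fiberTopology F).Point where
  fiber := F
  initiallySmall := initiallySmall_of_essentiallySmall _
  jointly_surjective _ hS x := hS x

theorem fiberTopology_W_iff [EssentiallySmall.{w} C] [HasSheafify (fiberTopology F) (Type w)]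
    [(fiberTopology F).WEqualsLocallyBijective (Type w)] {P Q : Cᵒᵖ ⥤ Type w} (f : P ⟶ Q) :
    (fiberTopology F).W f ↔ IsIso ((fiberPoint F).presheafFiber.map f) := by
  have hP : (ObjectProperty.singleton (fiberPoint F)).IsConservativeFamilyOfPoints :=
    .mk' fun _ S hS => hS ⟨_, ObjectProperty.ofObj_apply _ ()⟩
  rw [hP.W_iff]
  exact ⟨fun h => h ⟨_, ObjectProperty.ofObj_apply _ ()⟩, by rintro h ⟨_, ⟨⟩⟩; exact h⟩

end FiberTopology

section SmallGenerators

variable {C : Type v} [SmallCategory C] {E : Type w} [Category.{v} E] {ι : C ⥤ E}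
  {F : E ⥤ Type v}

/-- The stalk functor of `fiberPoint (ι ⋙ F)` factors through `E`: it is the composition of `F` with
the colimit-preserving extension of `ι` to presheaves. Both functors preserve colimits and restrict
to `ι ⋙ F` on representables. -/
noncomputable def fiberPointPresheafFiberIso [IsCofiltered (ι ⋙ F).Elements]
    [HasColimitsOfSize.{v, v} E] [PreservesColimitsOfSize.{v, v} F] :
    (fiberPoint (ι ⋙ F)).presheafFiber ≅ uliftYoneda.{v}.leftKanExtension ι ⋙ F :=
  let restrictStalk : ι ⋙ F ≅ uliftYoneda.{v} ⋙ (fiberPoint (ι ⋙ F)).presheafFiber :=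
    (fiberPoint (ι ⋙ F)).shrinkYonedaCompPresheafFiberIso.symm ≪≫
      Functor.isoWhiskerRight uliftYonedaIsoShrinkYoneda.symm _
  let restrictExtension : ι ⋙ F ≅ uliftYoneda.{v} ⋙ uliftYoneda.{v}.leftKanExtension ι ⋙ F :=
    Functor.isoWhiskerRight (Presheaf.isExtensionAlongULiftYoneda ι).symm F
  Presheaf.uniqueExtensionAlongULiftYoneda.{v} _ restrictStalk ≪≫
    (Presheaf.uniqueExtensionAlongULiftYoneda.{v} _ restrictExtension).symm

theorem CoversFibers.isGrothendieckTopos [ι.Full] [ι.Faithful] [HasFiniteLimits E]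
    [HasColimitsOfSize.{v, v} E] [PreservesFiniteLimits F] [PreservesColimitsOfSize.{v, v} F]
    [F.ReflectsIsomorphisms] (h : CoversFibers ι F) : IsGrothendieckTopos E := by
  have := h.isCofiltered_elements
  have := h.isDense
  let L := uliftYoneda.{v}.leftKanExtension ι
  let adj : L ⊣ Presheaf.restrictedULiftYoneda ι :=
    Presheaf.uliftYonedaAdjunction L (uliftYoneda.leftKanExtensionUnit ι)
  let J := fiberTopology (ι ⋙ F)
  have W_eq : J.W = (MorphismProperty.isomorphisms E).inverseImage L := by
    ext P Q f
    rw [fiberTopology_W_iff]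
    exact (NatIso.isIso_map_iff fiberPointPresheafFiberIso f).trans (isIso_iff_of_reflects_iso _ F)
  -- By density of `ι`, the right adjoint of `L` is fully faithful, so `L` is a localization.
  have : L.IsLocalization J.W := W_eq ▸ adj.isLocalization
  exact ⟨C, _, J, ⟨Localization.uniq L (presheafToSheaf J (Type v)) J.W⟩⟩

end SmallGenerators

/-! ### The category of continuous actions -/

theorem isLocallyConstant_iff_isOpen_setOf_eq {X : Type u} {Y : Type v} [TopologicalSpace X]
    {f : X → Y} : IsLocallyConstant f ↔ IsOpen {p : X × X | f p.1 = f p.2} := by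
  refine ⟨fun h => ?_, fun h => IsLocallyConstant.iff_isOpen_fiber_apply.2 fun x => ?_⟩
  · exact (h.comp_continuous continuous_fst).prodMk (h.comp_continuous continuous_snd)
      {q | q.1 = q.2}
  · exact h.preimage (f := fun y => (y, x)) (by fun_prop)

namespace PSh

variable {M : Type u} [Monoid M]

/-- The right `M`-set given by an explicit right action. -/
def ofAct (X : Type u) (a : X → M → X) (one : ∀ x, a x 1 = x)
    (mul : ∀ x m n, a x (m * n) = a (a x m) n) : PSh M where
  obj _ := X
  map f := ↾fun x => a x f.unop
  map_id _ := ConcreteCategory.hom_ext _ _ fun x => one x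
  map_comp f g := ConcreteCategory.hom_ext _ _ fun x => mul x f.unop g.unop

/-- The morphism of right `M`-sets given by an equivariant function. -/
def ofEquivariant {X Y : PSh M} (f : X.carrier → Y.carrier)
    (hf : ∀ x m, f (X.act x m) = Y.act (f x) m) : X ⟶ Y where
  app _ := ↾f
  naturality _ _ i := ConcreteCategory.hom_ext _ _ fun x => hf x i.unop

/-- The function underlying a morphism of right `M`-sets. -/
abbrev toFun {X Y : PSh M} (f : X ⟶ Y) : X.carrier → Y.carrier :=
  f.app (op (SingleObj.star M))

theorem comp_act {X Y : PSh M} (f : X ⟶ Y) (x : X.carrier) :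
    toFun f ∘ X.act x = Y.act (toFun f x) :=
  funext (map_act f x)

variable [TopologicalSpace M]

theorem isContinuous_iff {X : PSh M} :
    isContinuous M X ↔ ∀ x : X.carrier, IsLocallyConstant (X.act x) := by
  let _ : TopologicalSpace X.carrier := ⊥
  have : DiscreteTopology X.carrier := ⟨rfl⟩
  exact continuous_prod_of_discrete_left.trans
    (forall_congr' fun x => (IsLocallyConstant.iff_continuous (X.act x)).symm)

theorem isContinuous_of_surjective {X Y : PSh M} (f : X ⟶ Y) (hf : Function.Surjective (toFun f))
    (hX : isContinuous M X) : isContinuous M Y :=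
  isContinuous_iff.2 <| hf.forall.2 fun x =>
    comp_act f x ▸ (isContinuous_iff.1 hX x).comp (toFun f)

theorem isContinuous_of_jointly_injective {J : Type v} [Finite J] {X : PSh M} {Y : J → PSh M}
    (f : ∀ j, X ⟶ Y j) (hf : ∀ x y, (∀ j, toFun (f j) x = toFun (f j) y) → x = y)
    (hY : ∀ j, isContinuous M (Y j)) : isContinuous M X := by
  refine isContinuous_iff.2 fun x => (IsLocallyConstant.iff_eventually_eq _).2 fun m => ?_
  have hm (j : J) := (isContinuous_iff.1 (hY j) (toFun (f j) x)).eventually_eq m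
  filter_upwards [Filter.eventually_all.2 hm] with n hn
  exact hf _ _ fun j => (map_act (f j) x n).trans ((hn j).trans (map_act (f j) x m).symm)

instance isClosedUnderLimitsOfShape_isContinuous (J : Type) [SmallCategory J] [FinCategory J] :
    (isContinuous M).IsClosedUnderLimitsOfShape J where
  limitsOfShape_le _ := fun ⟨h⟩ =>
    isContinuous_of_jointly_injective h.π.app (Concrete.isLimit_ext _ (isLimitOfPreserves
      ((evaluation _ (Type u)).obj (op (SingleObj.star M))) h.isLimit)) h.prop_diag_obj

theorem mem_contElements_iff {X : PSh M} {x : X.carrier} :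
    x ∈ X.contElements.obj (op (SingleObj.star M)) ↔
      ∀ q : M, IsLocallyConstant (X.act (X.act x q)) :=
  forall_comm.trans (forall_congr' fun _ => IsLocallyConstant.iff_isOpen_fiber_apply.symm)

theorem mem_contElements_of_isContinuous {X : PSh M} (hX : isContinuous M X) (x : X.carrier) :
    x ∈ X.contElements.obj (op (SingleObj.star M)) :=
  mem_contElements_iff.2 fun q => isContinuous_iff.1 hX (X.act x q)

theorem mem_contElements_iff_rel (X : PSh M) (x : X.carrier) :
    x ∈ X.contElements.obj (op (SingleObj.star M)) ↔ ∀ q : M, IsOpen (X.rel (X.act x q)) :=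
  mem_contElements_iff.trans (forall_congr' fun _ => isLocallyConstant_iff_isOpen_setOf_eq)

theorem mem_contElements_iff_isLocallyConstant (hM : ∀ q : M, Continuous fun m : M => q * m)
    {X : PSh M} {x : X.carrier} :
    x ∈ X.contElements.obj (op (SingleObj.star M)) ↔ IsLocallyConstant (X.act x) := by
  refine mem_contElements_iff.trans ⟨fun h => X.act_one x ▸ h 1, fun h q => ?_⟩
  have act_act : X.act (X.act x q) = X.act x ∘ (q * ·) := funext fun m => (X.act_mul x q m).symm
  exact act_act ▸ h.comp_continuous (hM q)

end PSh

namespace ContSets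

variable (M : Type u) [Monoid M] [TopologicalSpace M]

/-- The coreflection of `M`-sets onto continuous `M`-sets: every element of a continuous `M`-set is
a continuous element. -/
def adjunction : V M ⊣ R M :=
  Adjunction.mkOfUnitCounit
    { unit :=
        { app := fun X => ObjectProperty.homMk
            { app := fun _ => ↾fun x => ⟨x, PSh.mem_contElements_of_isContinuous X.property x⟩
              naturality := fun _ _ _ => rfl }
          naturality := fun _ _ _ => rfl }
      counit :=
        { app := fun X => X.contElements.ι
          naturality := fun _ _ _ => rfl }
      left_triangle := rfl
      right_triangle := rfl }

theorem adjunction_counit_app (X : PSh M) : (adjunction M).counit.app X = X.contElements.ι := rfl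

instance : Coreflective (V M) where
  R := R M
  adj := adjunction M

theorem isEquivalence_comparison : (Comonad.comparison (adjunction M)).IsEquivalence :=
  ComonadicLeftAdjoint.eqv (L := V M)

instance : PreservesFiniteLimits (V M) where
  preservesFiniteLimits _ _ _ := inferInstance

instance : HasFiniteLimits (ContSets M) where
  out _ _ _ := inferInstance

instance : HasColimitsOfSize.{u, u} (ContSets M) := hasColimits_of_coreflective (V M)

theorem isHyperconnected : (GeometricMorphism.mk (R M) (V M) (adjunction M)
    inferInstance).IsHyperconnected where
  full := inferInstanceAs (V M).Full
  faithful := inferInstanceAs (V M).Faithful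
  subobjects X A i _ := by
    have hi : Function.Injective (PSh.toFun i) := (mono_iff_injective _).1 inferInstance
    exact ⟨⟨A, PSh.isContinuous_of_jointly_injective (fun _ : Unit => i)
      (fun _ _ h => hi (h ())) fun _ => X.property⟩, ⟨Iso.refl _⟩⟩
  quotients X A p _ := by
    have hp : Function.Surjective (PSh.toFun p) := (epi_iff_surjective _).1 inferInstance
    exact ⟨⟨A, PSh.isContinuous_of_surjective p hp X.property⟩, ⟨Iso.refl _⟩⟩

/-- The underlying set functor on continuous `M`-sets. -/
abbrev fiber : ContSets M ⥤ Type u :=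
  V M ⋙ (evaluation _ (Type u)).obj (op (SingleObj.star M))

/-- The adjunction that makes the underlying set functor a point of `ContSets M`; the direct image
functor sends a set to the continuous elements of the cofree `M`-set on it. -/
noncomputable def fiberAdjunction :
    fiber M ⊣ evaluationRightAdjoint (Type u) (op (SingleObj.star M)) ⋙ R M :=
  (adjunction M).comp (evaluationAdjunctionLeft (Type u) (op (SingleObj.star M)))

instance : (fiber M).IsLeftAdjoint := (fiberAdjunction M).isLeftAdjoint

instance : PreservesFiniteLimits (fiber M) := comp_preservesFiniteLimits _ _

instance : (fiber M).Faithful where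
  map_injective h := by
    refine ObjectProperty.hom_ext _ ?_
    ext ⟨⟨⟩⟩ x
    exact ConcreteCategory.congr_hom h x

instance : (fiber M).ReflectsIsomorphisms where
  reflects f hf := by
    have (U : (SingleObj M)ᵒᵖ) : IsIso (((V M).map f).app U) := hf
    have := NatIso.isIso_of_isIso_app ((V M).map f)
    exact isIso_of_reflects_iso f (V M)

theorem isTwoValued : IsTwoValued (ContSets M) := .of_reflectsIsomorphisms (fiber M)

theorem hasEnoughPoints : HasEnoughPoints (ContSets M) := .of_adjunction (fiberAdjunction M)

end ContSets

/-! ### Cyclic continuous actions -/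

/-- A right congruence on `M` such that the cyclic right `M`-set `M / r` is continuous: by `isOpen`,
the necessary clopens of the class of `q` are open. -/
structure ContCongr (M : Type u) [Monoid M] [TopologicalSpace M] extends Setoid M where
  mul_right : ∀ {a b : M} (n : M), r a b → r (a * n) (b * n)
  isOpen : ∀ q p : M, IsOpen {m | r (q * m) (q * p)}

namespace ContCongr

open ContSets

variable {M : Type u} [Monoid M] [TopologicalSpace M]

/-- The cyclic continuous `M`-set `M / r`. -/
def cyc (r : ContCongr M) : ContSets M where
  obj := PSh.ofAct (Quotient r.toSetoid)
    (fun x m => x.map (· * m) fun _ _ => r.mul_right m)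
    (fun x => x.inductionOn fun a => congrArg _ (mul_one a))
    (fun x m n => x.inductionOn fun a => congrArg _ (mul_assoc a m n).symm)
  property := PSh.isContinuous_iff.2 fun x => IsLocallyConstant.iff_isOpen_fiber_apply.2 fun p => by
    obtain ⟨q, rfl⟩ := Quotient.mk_surjective x
    convert r.isOpen q p using 1
    exact Set.ext fun m => Quotient.eq

/-- The generator of `M / r`, the class of `1`. -/
def generator (r : ContCongr M) : (fiber M).obj r.cyc := Quotient.mk r.toSetoid 1

theorem act_generator (r : ContCongr M) (a : M) :
    r.cyc.obj.act r.generator a = Quotient.mk r.toSetoid a :=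
  congrArg _ (one_mul a)

theorem surjective_of_map_eq_generator {r : ContCongr M} {X : ContSets M} {f : X ⟶ r.cyc}
    {x : (fiber M).obj X} (h : (fiber M).map f x = r.generator) :
    Function.Surjective ((fiber M).map f) := fun y => by
  obtain ⟨a, rfl⟩ := Quotient.mk_surjective y
  refine ⟨X.obj.act x a, (PSh.map_act f.hom x a).trans ?_⟩
  exact (congrArg (r.cyc.obj.act · a) h).trans (r.act_generator a)

/-- The congruence relating `a` and `b` when `x a = x b`, for an element `x` of a continuous
`M`-set. -/
def ker (X : ContSets M) (x : (fiber M).obj X) : ContCongr M where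
  toSetoid := Setoid.ker (X.obj.act x)
  mul_right {a b} n (h : X.obj.act x a = X.obj.act x b) :=
    show X.obj.act x (a * n) = X.obj.act x (b * n) by rw [PSh.act_mul, PSh.act_mul, h]
  isOpen q p := by
    convert (PSh.isContinuous_iff.1 X.property (X.obj.act x q)).isOpen_fiber (X.obj.act x (q * p))
    exact Eq.congr_left (X.obj.act_mul x q _)

/-- The isomorphism from `M / ker x` onto the orbit of `x`, as a morphism to `X`. -/
def orbit (X : ContSets M) (x : (fiber M).obj X) : (ker X x).cyc ⟶ X :=
  ObjectProperty.homMk (PSh.ofEquivariant (X := (ker X x).cyc.obj)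
    (Setoid.kerLift (X.obj.act x))
    fun y m => y.inductionOn fun a => X.obj.act_mul x a m)

theorem orbit_generator (X : ContSets M) (x : (fiber M).obj X) :
    (fiber M).map (orbit X x) (ker X x).generator = x :=
  X.obj.act_one x

theorem orbit_injective (X : ContSets M) (x : (fiber M).obj X) :
    Function.Injective ((fiber M).map (orbit X x)) :=
  Setoid.kerLift_injective (X.obj.act x)

theorem jointlyEpic_orbit (X : ContSets M) : JointlyEpic (orbit X) :=
  (jointlyEpic_iff_jointly_surjective (fiber M)).2 fun x => ⟨x, _, orbit_generator X x⟩

theorem supercompact_cyc (r : ContCongr M) : supercompact (ContSets M) r.cyc := by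
  intro I A f hf
  obtain ⟨i, a, h⟩ := (jointlyEpic_iff_jointly_surjective (fiber M)).1 hf r.generator
  exact ⟨i, (fiber M).epi_of_epi_map
    ((epi_iff_surjective _).2 (surjective_of_map_eq_generator h))⟩

theorem exists_iso_cyc_of_supercompact {X : ContSets M} (hX : supercompact (ContSets M) X) :
    ∃ r : ContCongr M, Nonempty (X ≅ r.cyc) := by
  obtain ⟨x, _⟩ := hX _ _ _ (jointlyEpic_orbit X)
  have bijective : Function.Bijective ((fiber M).map (orbit X x)) :=
    ⟨orbit_injective X x, (epi_iff_surjective _).1 inferInstance⟩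
  have := (isIso_iff_of_reflects_iso _ (fiber M)).1 ((isIso_iff_bijective _).2 bijective)
  exact ⟨ker X x, ⟨(asIso (orbit X x)).symm⟩⟩

variable (M) in
theorem coversFibers_cyc : CoversFibers (inducedFunctor (cyc (M := M))) (fiber M) :=
  fun X x => ⟨ker X x, orbit X x, _, orbit_generator X x⟩

end ContCongr

namespace ContSets

variable (M : Type u) [Monoid M] [TopologicalSpace M]

theorem isSupercompactlyGenerated : IsSupercompactlyGenerated (ContSets M) where
  essentiallySmall := ⟨ObjectProperty.ofObj (ContCongr.cyc (M := M)), inferInstance, fun _ hX =>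
    have ⟨r, ⟨e⟩⟩ := ContCongr.exists_iso_cyc_of_supercompact hX
    ⟨_, ObjectProperty.ofObj_apply _ r, ⟨e⟩⟩⟩
  isSeparating _ _ _ _ h :=
    ContCongr.jointlyEpic_orbit _ _ _ fun _ => h _ (ContCongr.supercompact_cyc _) _

theorem isGrothendieckTopos : IsGrothendieckTopos (ContSets M) :=
  (ContCongr.coversFibers_cyc M).isGrothendieckTopos

end ContSets

theorem mainTheorem1 (M : Type u) [Monoid M] [TopologicalSpace M] :
    -- `V` is left exact and comonadic with right adjoint `R`, the counit being the inclusion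
    -- of the continuous elements, and `V ⊣ R` is a hyperconnected geometric morphism
    (∃ (leftExact : PreservesFiniteLimits (ContSets.V M)) (adj : ContSets.V M ⊣ ContSets.R M),
      (∀ X : PSh M, adj.counit.app X = X.contElements.ι) ∧
      (Comonad.comparison adj).IsEquivalence ∧
      (GeometricMorphism.mk (ContSets.R M) (ContSets.V M) adj leftExact).IsHyperconnected) ∧
    -- the continuous elements in terms of open relations
    (∀ (X : PSh M) (x : X.carrier),
      x ∈ X.contElements.obj (op (SingleObj.star M)) ↔ ∀ q : M, IsOpen (X.rel (X.act x q))) ∧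
    -- simplified expressions when every left multiplication is continuous
    ((∀ q : M, Continuous fun m : M => q * m) → ∀ (X : PSh M) (x : X.carrier),
      (x ∈ X.contElements.obj (op (SingleObj.star M)) ↔
        ∀ p : M, IsOpen (X.necessaryClopen x p)) ∧
      (x ∈ X.contElements.obj (op (SingleObj.star M)) ↔ IsOpen (X.rel x))) ∧
    IsElementaryTopos (ContSets M) ∧
    IsGrothendieckTopos (ContSets M) ∧
    IsSupercompactlyGenerated (ContSets M) ∧
    IsTwoValued (ContSets M) ∧
    HasEnoughPoints (ContSets M) :=
  ⟨⟨inferInstance, ContSets.adjunction M, ContSets.adjunction_counit_app M,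
      ContSets.isEquivalence_comparison M, ContSets.isHyperconnected M⟩,
    PSh.mem_contElements_iff_rel,
    fun hM _ _ =>
      ⟨(PSh.mem_contElements_iff_isLocallyConstant hM).trans
        IsLocallyConstant.iff_isOpen_fiber_apply,
      (PSh.mem_contElements_iff_isLocallyConstant hM).trans isLocallyConstant_iff_isOpen_setOf_eq⟩,
    (ContSets.isGrothendieckTopos M).isElementaryTopos,
    ContSets.isGrothendieckTopos M,
    ContSets.isSupercompactlyGenerated M,
    ContSets.isTwoValued M,
    ContSets.hasEnoughPoints M⟩
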